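/- Let $n\ge 2$, let $\mathbb{R}^n_+=\{(x,t): x\in\mathbb{R}^{n-1},\ t>0\}$ be the upper half-space, and let $$K(x,t)=\frac{\Gamma(n/2)}{\pi^{n/2}}\,\frac{t}{(|x|^2+t^2)^{n/2}}$$ be its Poisson kernel. Let $u$ be a positive harmonic function in $\mathbb{R}^n_+$ with boundary measure $\mu$; that is, $\mu$ is the non-negative Borel measure on $\mathbb{R}^{n-1}$ with $\int_{\mathbb{R}^{n-1}} (|x|^2+1)^{-n/2}\,d\mu(x)<\infty$ such that, for some constant $C\ge 0$, $$u(x,t)=Ct+\int_{\mathbb{R}^{n-1}}K(x-\xi,t)\,d\mu(\xi)\qquad (x\in\mathbb{R}^{n-1},\ t>0).$$ Write $B(r)$ for the open ball of radius $r$ in $\mathbb{R}^{n-1}$ centered at the origin, and let $\alpha\in(-1,n-1)$. Then the following are equivalent: (i) there exists $a\in[0,\infty)$ such that $u(0,t)\,t^{\alpha}\to a$ as $t\to 0+$; (ii) there exists $b\in[0,\infty)$ such that $\dfrac{\mu(B(r))}{r^{n-1}}\,r^{\alpha}\to b$ as $r\to 0+$. If these limits exist, then $$a=b\,\frac{\Gamma\left(\frac{n-\alpha+1}{2}\right)\Gamma\left(\frac{\alpha+1}{2}\right)}{\pi^{n/2}}.$$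 -/

import Mathlib

open Filter Topology MeasureTheory InnerProductSpace

noncomputable section

/-- The Euclidean space `ℝ^{n-1} × ℝ` (with its `ℓ²` norm and inner product), whose points are
written `(x, t)`: a model of `ℝ^n`. -/
abbrev ProdSpace (n : ℕ) : Type :=
  WithLp 2 (EuclideanSpace ℝ (Fin (n - 1)) × ℝ)

/-- The point `(x, t)` of `ℝ^{n-1} × ℝ`. -/
def point {n : ℕ} (x : EuclideanSpace ℝ (Fin (n - 1))) (t : ℝ) : ProdSpace n :=
  WithLp.toLp 2 (x, t)

/-- The open upper half-space `{(x, t) : t > 0}`. -/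
def upperHalfSpace (n : ℕ) : Set (ProdSpace n) :=
  {p | 0 < p.snd}

/-- A positive harmonic function in the upper half-space. Values outside it are irrelevant. -/
structure IsPositiveHarmonic (n : ℕ) (u : ProdSpace n → ℝ) : Prop where
  harmonic : HarmonicOnNhd u (upperHalfSpace n)
  pos : ∀ p ∈ upperHalfSpace n, 0 < u p

/-- The Poisson kernel `K(x, t) = Γ(n/2) π^{-n/2} t / (|x|² + t²)^{n/2}` of the upper half-space. -/
def halfSpacePoissonKernel (n : ℕ) (x : EuclideanSpace ℝ (Fin (n - 1))) (t : ℝ) : ℝ :=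
  (Real.Gamma ((n : ℝ) / 2) / Real.pi ^ ((n : ℝ) / 2)) * t /
    (‖x‖ ^ 2 + t ^ 2) ^ ((n : ℝ) / 2)

/-- `μ` is the boundary measure of `u`: it is a nonnegative Borel measure on `ℝ^{n-1}` such that
`∫ (|x|² + 1)^{-n/2} dμ(x) < ∞` and, for some constant `C ≥ 0`,
`u(x, t) = C t + ∫ K(x - ξ, t) dμ(ξ)` for all `x` and all `t > 0`. -/
structure IsBoundaryMeasure (n : ℕ) (u : ProdSpace n → ℝ)
    (μ : Measure (EuclideanSpace ℝ (Fin (n - 1)))) : Prop where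
  integrable : Integrable (fun x => 1 / (‖x‖ ^ 2 + 1) ^ ((n : ℝ) / 2)) μ
  representation : ∃ C : ℝ, 0 ≤ C ∧ ∀ (x : EuclideanSpace ℝ (Fin (n - 1))) (t : ℝ), 0 < t →
    u (point x t) = C * t + ∫ ξ, halfSpacePoissonKernel n (x - ξ) t ∂μ

end

/-! On the axis the Poisson integral sees only the distribution of `f = ‖ξ‖ ^ 2` under `μ`. With `τ
= t ^ 2`, `p = n / 2` and `γ = (n - 1 - α) / 2`, the quantity `u(0,t) t ^ α` is `C t ^ (α + 1)`,
which tends to 0, plus a constant times the normalized Stieltjes transform `τ ^ (p - γ) ∫ (f + τ) ^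
(-p) ∂μ`. The ball ratio at `r` is `v ^ (-γ) μ{f < v}` at `v = r ^ 2`. The theorem is therefore an
Abelian and a Tauberian theorem for this transform, with ratio of limits `κ = p B(p - γ, γ + 1)`.

The Abelian half (`tendsto_rpow_mul_integral_stieltjes`) is the layer-cake formula and dominated
convergence; the part of `μ` away from `f = 0` contributes `O(τ ^ (p - γ))`.

The Tauberian half (`tendsto_rpow_mul_measureReal_of_stieltjes`) is Karamata's method. In the
variable `x = τ / (f + τ)`, transforms at the points `e ^ y τ` are values of one positive functional
on `C([0,1])` at the functions `(1 - x + e ^ y x) ^ (-p)`. Differentiating in `y` at 0 yields all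
monomials, so these functions span a dense subspace (`eq_top_of_stieltjesCurve_mem`). The
functionals then converge on every continuous function to that of a model measure with distribution
function a multiple of `v ^ γ`; continuous cutoffs recover the distribution function. -/

/-! ### Density of the Stieltjes kernels in `C([0,1])` -/

lemma one_sub_add_mul_pos {x l : ℝ} (hx : x ∈ Set.Icc (0 : ℝ) 1) (hl : 0 < l) :
    0 < 1 - x + l * x := by
  rcases eq_or_lt_of_le hx.1 with h | h
  · simp [← h]
  · nlinarith [hx.2, mul_pos hl h]

lemma continuous_stieltjesCurve_uncurry (p : ℝ) (k : ℕ) :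
    Continuous (fun z : ℝ × unitInterval =>
      (z.2 : ℝ) ^ k * (1 - (z.2 : ℝ) + Real.exp z.1 * z.2) ^ (-p - k)) := by
  refine Continuous.mul (by fun_prop) (Continuous.rpow_const (by fun_prop) fun z => Or.inl ?_)
  exact (one_sub_add_mul_pos z.2.2 (Real.exp_pos _)).ne'

/-- The function `x ↦ x ^ k (1 - x + e ^ y x) ^ (-p - k)` on the unit interval. For `k = 0` and
`x = 1 / (1 + s)` it is the Stieltjes kernel `(s + e ^ y) ^ (-p)`, up to the factor `(s + 1) ^ p`. -/
noncomputable def stieltjesCurve (p : ℝ) (k : ℕ) (y : ℝ) : C(unitInterval, ℝ) where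
  toFun x := (x : ℝ) ^ k * (1 - (x : ℝ) + Real.exp y * x) ^ (-p - k)
  continuous_toFun := (continuous_stieltjesCurve_uncurry p k).comp (Continuous.prodMk_right y)

lemma continuous_stieltjesCurve (p : ℝ) (k : ℕ) : Continuous (stieltjesCurve p k) :=
  (ContinuousMap.curry ⟨_, continuous_stieltjesCurve_uncurry p k⟩).continuous

lemma hasDerivAt_stieltjesCurve_apply (p : ℝ) (k : ℕ) (y : ℝ) (x : unitInterval) :
    HasDerivAt (fun y => stieltjesCurve p k y x)
      (-(p + k) * Real.exp y * stieltjesCurve p (k + 1) y x) y := by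
  have hpos := one_sub_add_mul_pos x.2 (Real.exp_pos y)
  have h1 : HasDerivAt (fun y => 1 - (x : ℝ) + Real.exp y * x) (Real.exp y * x) y :=
    ((Real.hasDerivAt_exp y).mul_const _).const_add _
  have h2 := (h1.rpow_const (p := -p - k) (Or.inl hpos.ne')).const_mul ((x : ℝ) ^ k)
  refine h2.congr_deriv ?_
  simp only [stieltjesCurve, ContinuousMap.coe_mk, Nat.cast_add, Nat.cast_one]
  rw [show -p - (k : ℝ) - 1 = -p - (k + 1) by ring]
  ring

/-- Pointwise derivatives become a sup-norm derivative because the candidate derivative is a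
continuous curve in `C([0,1])`: its integral is identified by evaluating at each `x`, and the
vector-valued fundamental theorem of calculus applies. -/
lemma hasDerivAt_stieltjesCurve (p : ℝ) (k : ℕ) (y : ℝ) :
    HasDerivAt (stieltjesCurve p k)
      ((-(p + k) * Real.exp y) • stieltjesCurve p (k + 1) y) y := by
  set D : ℝ → C(unitInterval, ℝ) := fun y => (-(p + k) * Real.exp y) • stieltjesCurve p (k + 1) y
  have hD : Continuous D := by
    have := continuous_stieltjesCurve p (k + 1)
    fun_prop
  have key : stieltjesCurve p k = fun y => stieltjesCurve p k 0 + ∫ v in (0 : ℝ)..y, D v := by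
    funext y
    ext x
    have h1 : (∫ v in (0 : ℝ)..y, D v) x = ∫ v in (0 : ℝ)..y, D v x :=
      ((ContinuousMap.evalCLM ℝ x).intervalIntegral_comp_comm (hD.intervalIntegrable 0 y)).symm
    have h2 : ∫ v in (0 : ℝ)..y, D v x = stieltjesCurve p k y x - stieltjesCurve p k 0 x := by
      refine intervalIntegral.integral_eq_sub_of_hasDerivAt
        (fun v _ => hasDerivAt_stieltjesCurve_apply p k v x) ?_
      exact ((ContinuousMap.evalCLM ℝ x).continuous.comp hD).intervalIntegrable 0 y
    rw [ContinuousMap.add_apply, h1, h2]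
    ring
  rw [key]
  exact (intervalIntegral.integral_hasDerivAt_right (hD.intervalIntegrable 0 y)
    hD.stronglyMeasurable.stronglyMeasurableAtFilter hD.continuousAt).const_add _

/-- Difference quotients stay in `V`, and so do their limits. The factor `-(p + k) e ^ y` never
vanishes since `p > 0`, so it can be divided out. -/
lemma stieltjesCurve_mem {p : ℝ} (hp : 0 < p) {V : Submodule ℝ C(unitInterval, ℝ)}
    (hV : IsClosed (V : Set C(unitInterval, ℝ))) (h0 : ∀ y, stieltjesCurve p 0 y ∈ V)
    (k : ℕ) (y : ℝ) : stieltjesCurve p k y ∈ V := by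
  induction k generalizing y with
  | zero => exact h0 y
  | succ k ih =>
    have h := (hasDerivAt_stieltjesCurve p k y).tendsto_slope
    have hmem : ((-(p + k) * Real.exp y) • stieltjesCurve p (k + 1) y) ∈ V := by
      refine hV.mem_of_tendsto h (Eventually.of_forall fun z => ?_)
      exact V.smul_mem _ (V.sub_mem (ih z) (ih y))
    refine (V.smul_mem_iff (mul_ne_zero ?_ (Real.exp_pos y).ne')).1 hmem
    have : (0 : ℝ) ≤ k := Nat.cast_nonneg k
    linarith

/-- At `y = 0` the base `1 - x + e ^ y x` is 1, so the `k`-th curve is the monomial `x ^ k`; the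
Weierstrass theorem finishes. -/
theorem eq_top_of_stieltjesCurve_mem {p : ℝ} (hp : 0 < p)
    {V : Submodule ℝ C(unitInterval, ℝ)} (hV : IsClosed (V : Set C(unitInterval, ℝ)))
    (h0 : ∀ y, stieltjesCurve p 0 y ∈ V) : V = ⊤ := by
  have hmono (k : ℕ) : (Polynomial.X ^ k : Polynomial ℝ).toContinuousMapOn unitInterval ∈ V := by
    convert stieltjesCurve_mem hp hV h0 k 0 using 1
    ext x
    simp [stieltjesCurve]
  have hpoly (q : Polynomial ℝ) : q.toContinuousMapOn unitInterval ∈ V := by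
    have h2 : q.toContinuousMapOn unitInterval = ∑ i ∈ Finset.range (q.natDegree + 1),
        q.coeff i • (Polynomial.X ^ i : Polynomial ℝ).toContinuousMapOn unitInterval := by
      ext x
      simp [Polynomial.eval_eq_sum_range]
    rw [h2]
    exact V.sum_mem fun i _ => V.smul_mem _ (hmono i)
  rw [eq_top_iff]
  intro g _
  have hg : g ∈ (polynomialFunctions unitInterval).topologicalClosure := by
    rw [polynomialFunctions_closure_eq_top']; trivial
  have hg' : g ∈ closure (polynomialFunctions unitInterval : Set C(unitInterval, ℝ)) := hg
  refine closure_minimal ?_ hV hg'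
  rw [polynomialFunctions_coe]
  rintro _ ⟨q, rfl⟩
  exact hpoly q

lemma abs_map_le_norm_mul {Φ : C(unitInterval, ℝ) →ₗ[ℝ] ℝ} (hΦ : ∀ g, 0 ≤ g → 0 ≤ Φ g)
    (g : C(unitInterval, ℝ)) : |Φ g| ≤ ‖g‖ * Φ 1 := by
  have h1 := hΦ (‖g‖ • 1 - g) fun x => by
    simpa using (le_abs_self _).trans (g.norm_coe_le_norm x)
  have h2 := hΦ (‖g‖ • 1 + g) fun x => by
    have := (neg_le_abs _).trans (g.norm_coe_le_norm x)
    simpa using by linarith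
  simp only [map_sub, map_add, map_smul, smul_eq_mul] at h1 h2
  exact abs_le.2 ⟨by linarith, by linarith⟩

/-- Positive functionals on `C([0, 1])` converge pointwise once they converge on the Stieltjes
kernels. -/
theorem tendsto_of_tendsto_stieltjesCurve {ι : Type*} {l : Filter ι} {p : ℝ} (hp : 0 < p)
    {Φ : ι → C(unitInterval, ℝ) →ₗ[ℝ] ℝ} {Ψ : C(unitInterval, ℝ) →ₗ[ℝ] ℝ}
    (hΦ : ∀ i, ∀ g, 0 ≤ g → 0 ≤ Φ i g) (hΨ : ∀ g, 0 ≤ g → 0 ≤ Ψ g)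
    (h : ∀ y, Tendsto (fun i => Φ i (stieltjesCurve p 0 y)) l (𝓝 (Ψ (stieltjesCurve p 0 y))))
    (g : C(unitInterval, ℝ)) : Tendsto (fun i => Φ i g) l (𝓝 (Ψ g)) := by
  let V : Submodule ℝ C(unitInterval, ℝ) :=
    { carrier := {g | Tendsto (fun i => Φ i g) l (𝓝 (Ψ g))}
      add_mem' := fun {a b} ha hb => by
        simpa only [Set.mem_ofPred_eq, map_add] using Tendsto.add ha hb
      zero_mem' := by simp [tendsto_const_nhds]
      smul_mem' := fun c a ha => by
        simpa only [Set.mem_ofPred_eq, map_smul] using Tendsto.const_smul ha c }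
  have hone : stieltjesCurve p 0 0 = 1 := by
    ext x
    simp [stieltjesCurve]
  -- The constant 1 is itself a Stieltjes kernel, so the masses `Φ i 1` converge. Being eventually
  -- bounded, they make the functionals equicontinuous, and the set of convergence is closed by a
  -- three-epsilon argument.
  have hbd : ∀ᶠ i in l, Φ i 1 < Ψ 1 + 1 :=
    (hone ▸ h 0).eventually_lt_const (by linarith)
  have hΨ1 : 0 ≤ Ψ 1 := hΨ 1 zero_le_one
  have hV : IsClosed (V : Set C(unitInterval, ℝ)) := by
    refine isClosed_of_closure_subset fun f hf => ?_
    change Tendsto (fun i => Φ i f) l (𝓝 (Ψ f))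
    rw [Metric.tendsto_nhds]
    intro ε hε
    obtain ⟨f', hf', hd⟩ := Metric.mem_closure_iff.1 hf (ε / (3 * (Ψ 1 + 1))) (by positivity)
    rw [dist_eq_norm, lt_div_iff₀ (by positivity)] at hd
    have hconv : Tendsto (fun i => Φ i f') l (𝓝 (Ψ f')) := hf'
    filter_upwards [hbd, (Metric.tendsto_nhds.1 hconv) (ε / 3) (by positivity)] with i hi hi'
    have h1 := abs_map_le_norm_mul (hΦ i) (f - f')
    have h2 := abs_map_le_norm_mul hΨ (f - f')
    have h3 : ‖f - f'‖ * Φ i 1 ≤ ‖f - f'‖ * (Ψ 1 + 1) := by gcongr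
    have h4 : ‖f - f'‖ * Ψ 1 ≤ ‖f - f'‖ * (Ψ 1 + 1) := by gcongr; linarith
    rw [map_sub] at h1 h2
    rw [Real.dist_eq] at hi' ⊢
    rw [abs_le] at h1 h2
    rw [abs_lt] at hi' ⊢
    constructor <;> linarith [h1.1, h1.2, h2.1, h2.2, hi'.1, hi'.2]
  have hVtop := eq_top_of_stieltjesCurve_mem hp hV h
  have : g ∈ V := hVtop ▸ Submodule.mem_top
  exact this

/-! ### Abelian theorem for the Stieltjes transform -/

lemma setIntegral_rpow_mul_one_sub_rpow {a b : ℝ} (ha : 0 < a) (hb : 0 < b) :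
    ∫ x in Set.Ioo (0 : ℝ) 1, x ^ (a - 1) * (1 - x) ^ (b - 1) = ProbabilityTheory.beta a b := by
  have hB := ProbabilityTheory.beta_pos ha hb
  have h1 : ∫ x in Set.Ioo (0 : ℝ) 1,
      1 / ProbabilityTheory.beta a b * x ^ (a - 1) * (1 - x) ^ (b - 1) = 1 := by
    rw [integral_eq_lintegral_of_nonneg_ae, ← ProbabilityTheory.lintegral_betaPDF,
      ProbabilityTheory.lintegral_betaPDF_eq_one ha hb, ENNReal.toReal_one]
    · refine (ae_restrict_iff' measurableSet_Ioo).2 (Eventually.of_forall fun x hx => ?_)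
      have := hx.1.le
      have := sub_nonneg.2 hx.2.le
      simp only [Pi.zero_apply]
      positivity
    · exact Measurable.aestronglyMeasurable (by fun_prop)
  simp_rw [mul_assoc] at h1
  rw [integral_const_mul] at h1
  field_simp at h1
  exact h1

section Stieltjes

variable {X : Type*} [MeasurableSpace X] {μ : Measure X} {f : X → ℝ}

/-- Layer-cake formula for `τ / (f + τ)`: this ratio is at most 1, so only levels in `(0,1)` count,
and it exceeds `x` exactly when `f < τ (1 - x) / x`. -/
lemma integral_stieltjes_eq_setIntegral (hf : Measurable f) (hf0 : ∀ x, 0 ≤ f x)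
    (hfin : ∀ v, μ {x | f x < v} ≠ ⊤) {p τ : ℝ} (hp : 0 < p) (hτ : 0 < τ) :
    ∫ x, (τ / (f x + τ)) ^ p ∂μ =
      p * ∫ x in Set.Ioo (0 : ℝ) 1, μ.real {y | f y < τ * ((1 - x) / x)} * x ^ (p - 1) := by
  have hpos (x : X) : 0 < f x + τ := by linarith [hf0 x]
  have hmono : Monotone fun v => μ {y | f y < v} :=
    fun v w hvw => measure_mono fun y (hy : f y < v) => hy.trans_le hvw
  have hmeas : Measurable fun x : ℝ => μ {y | f y < τ * ((1 - x) / x)} :=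
    hmono.measurable.comp (by fun_prop)
  rw [integral_eq_lintegral_of_nonneg_ae
      (Eventually.of_forall fun x => by have := hpos x; simp only [Pi.zero_apply]; positivity)
      (Measurable.aestronglyMeasurable (by fun_prop)),
    lintegral_rpow_eq_lintegral_meas_lt_mul μ
      (Eventually.of_forall fun x => by have := hpos x; simp only [Pi.zero_apply]; positivity)
      (Measurable.aemeasurable (by fun_prop)) hp,
    ENNReal.toReal_mul, ENNReal.toReal_ofReal hp.le]
  congr 1
  rw [integral_eq_lintegral_of_nonneg_ae]
  · congr 1
    have hzero : ∀ t ∈ Set.Ioi (0 : ℝ) \ Set.Ioo 0 1,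
        μ {a | t < τ / (f a + τ)} * ENNReal.ofReal (t ^ (p - 1)) = 0 := by
      rintro t ⟨ht, ht'⟩
      have ht1 : 1 ≤ t := not_lt.1 fun h => ht' ⟨ht, h⟩
      have : {a | t < τ / (f a + τ)} = ∅ := by
        refine Set.eq_empty_of_forall_notMem fun a ha => ?_
        have h1 : τ / (f a + τ) ≤ 1 := (div_le_one (hpos a)).2 (by linarith [hf0 a])
        exact absurd (ht1.trans_lt ha) (not_lt.2 h1)
      simp [this]
    rw [← lintegral_inter_add_sdiff _ (Set.Ioi (0 : ℝ)) (measurableSet_Ioo (a := (0 : ℝ)) (b := 1)),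
      setLIntegral_congr_fun (measurableSet_Ioi.diff measurableSet_Ioo) hzero, lintegral_zero,
      add_zero, Set.inter_eq_right.2 Set.Ioo_subset_Ioi_self]
    refine setLIntegral_congr_fun measurableSet_Ioo fun t ht => ?_
    have hset : {a | t < τ / (f a + τ)} = {y | f y < τ * ((1 - t) / t)} := by
      ext a
      have h1 : t < τ / (f a + τ) ↔ t * (f a + τ) < τ := lt_div_iff₀ (hpos a)
      have h2 : f a < τ * ((1 - t) / t) ↔ f a * t < τ * (1 - t) := by
        rw [mul_div_assoc', lt_div_iff₀ ht.1]
      change _ ↔ f a < _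
      rw [h2]
      change t < τ / (f a + τ) ↔ _
      rw [h1]
      constructor <;> intro h <;> nlinarith
    simp only [hset]
    rw [ENNReal.ofReal_mul measureReal_nonneg, ofReal_measureReal (hfin _)]
  · refine (ae_restrict_iff' measurableSet_Ioo).2 (Eventually.of_forall fun x hx => ?_)
    have := hx.1.le
    simp only [Pi.zero_apply]
    positivity
  · exact (hmeas.ennreal_toReal.mul (by fun_prop)).aestronglyMeasurable

lemma integral_div_rpow_eq (hf0 : ∀ x, 0 ≤ f x) {p τ : ℝ} (hτ : 0 < τ) :
    ∫ x, (τ / (f x + τ)) ^ p ∂μ = τ ^ p * ∫ x, (f x + τ) ^ (-p) ∂μ := by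
  rw [← integral_const_mul]
  congr 1
  ext x
  have hpos : 0 < f x + τ := by linarith [hf0 x]
  rw [Real.div_rpow hτ.le hpos.le, Real.rpow_neg hpos.le, div_eq_mul_inv]

lemma rpow_mul_integral_stieltjes_eq (hf : Measurable f) (hf0 : ∀ x, 0 ≤ f x)
    (hfin : ∀ v, μ {x | f x < v} ≠ ⊤) {p γ τ : ℝ} (hp : 0 < p) (hτ : 0 < τ) :
    τ ^ (p - γ) * ∫ x, (f x + τ) ^ (-p) ∂μ =
      p * ∫ x in Set.Ioo (0 : ℝ) 1,
        τ ^ (-γ) * μ.real {y | f y < τ * ((1 - x) / x)} * x ^ (p - 1) := by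
  have h := integral_stieltjes_eq_setIntegral hf hf0 hfin hp hτ
  rw [integral_div_rpow_eq hf0 hτ] at h
  simp_rw [mul_assoc]
  rw [integral_const_mul, mul_left_comm p, ← h, ← mul_assoc, ← Real.rpow_add hτ,
    neg_add_eq_sub]

lemma rpow_div_mul_rpow {p γ x : ℝ} (hx : x ∈ Set.Ioo (0 : ℝ) 1) :
    ((1 - x) / x) ^ γ * x ^ (p - 1) = x ^ (p - γ - 1) * (1 - x) ^ (γ + 1 - 1) := by
  rw [Real.div_rpow (sub_nonneg.2 hx.2.le) hx.1.le, div_mul_eq_mul_div, mul_div_assoc,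
    ← Real.rpow_sub hx.1, add_sub_cancel_right, mul_comm]
  ring_nf

lemma setIntegral_div_rpow {p γ : ℝ} (hγ : 0 < γ) (hγp : γ < p) :
    ∫ x in Set.Ioo (0 : ℝ) 1, ((1 - x) / x) ^ γ * x ^ (p - 1) =
      ProbabilityTheory.beta (p - γ) (γ + 1) := by
  rw [← setIntegral_rpow_mul_one_sub_rpow (by linarith) (by linarith)]
  exact setIntegral_congr_fun measurableSet_Ioo fun x hx => rpow_div_mul_rpow hx

lemma integrableOn_div_rpow {p γ : ℝ} (hγ : 0 < γ) (hγp : γ < p) :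
    IntegrableOn (fun x : ℝ => ((1 - x) / x) ^ γ * x ^ (p - 1)) (Set.Ioo 0 1) := by
  -- A non-integrable function has Bochner integral 0 by convention, whereas this integral is a
  -- positive Beta value.
  refine Integrable.of_integral_ne_zero ?_
  rw [setIntegral_div_rpow hγ hγp]
  exact (ProbabilityTheory.beta_pos (by linarith) (by linarith)).ne'

/-- The Stieltjes transform of a measure with distribution function `v ^ γ`. -/
lemma rpow_mul_integral_stieltjes_of_eq_rpow (hf : Measurable f) (hf0 : ∀ x, 0 ≤ f x)
    {p γ τ : ℝ} (hγ : 0 < γ) (hγp : γ < p)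
    (h : ∀ v, 0 < v → μ {x | f x < v} = ENNReal.ofReal (v ^ γ)) (hτ : 0 < τ) :
    τ ^ (p - γ) * ∫ x, (f x + τ) ^ (-p) ∂μ = p * ProbabilityTheory.beta (p - γ) (γ + 1) := by
  have hfin (v : ℝ) : μ {x | f x < v} ≠ ⊤ := by
    rcases lt_or_ge 0 v with hv | hv
    · simp [h v hv]
    · have : {x | f x < v} = ∅ :=
        Set.eq_empty_of_forall_notMem fun x hx => absurd (hv.trans (hf0 x)) (not_le.2 hx)
      simp [this]
  rw [rpow_mul_integral_stieltjes_eq hf hf0 hfin (hγ.trans hγp) hτ,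
    ← setIntegral_div_rpow hγ hγp]
  congr 1
  refine setIntegral_congr_fun measurableSet_Ioo fun x hx => ?_
  have hw : 0 < (1 - x) / x := div_pos (sub_pos.2 hx.2) hx.1
  simp only [measureReal_def]
  rw [h _ (mul_pos hτ hw), ENNReal.toReal_ofReal (by positivity), Real.mul_rpow hτ.le hw.le,
    ← mul_assoc, ← Real.rpow_add hτ]
  simp

/-- The global bound `C v ^ γ` makes the layer-cake integrand at most `C` times the Beta integrand,
uniformly in `τ`, so dominated convergence applies. -/
lemma tendsto_rpow_mul_integral_stieltjes_of_le (hf : Measurable f) (hf0 : ∀ x, 0 ≤ f x)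
    {p γ b C : ℝ} (hγ : 0 < γ) (hγp : γ < p) (hfin : ∀ v, μ {x | f x < v} ≠ ⊤)
    (hC : ∀ v, 0 < v → μ.real {x | f x < v} ≤ C * v ^ γ)
    (h : Tendsto (fun v => v ^ (-γ) * μ.real {x | f x < v}) (𝓝[>] 0) (𝓝 b)) :
    Tendsto (fun τ => τ ^ (p - γ) * ∫ x, (f x + τ) ^ (-p) ∂μ) (𝓝[>] 0)
      (𝓝 (b * (p * ProbabilityTheory.beta (p - γ) (γ + 1)))) := by
  have hmono : Monotone fun v => μ.real {y | f y < v} := fun v w hvw =>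
    measureReal_mono (fun y (hy : f y < v) => hy.trans_le hvw) (hfin w)
  have key : Tendsto (fun τ => ∫ x in Set.Ioo (0 : ℝ) 1,
      τ ^ (-γ) * μ.real {y | f y < τ * ((1 - x) / x)} * x ^ (p - 1)) (𝓝[>] 0)
      (𝓝 (∫ x in Set.Ioo (0 : ℝ) 1, b * (((1 - x) / x) ^ γ * x ^ (p - 1)))) := by
    refine tendsto_integral_filter_of_dominated_convergence
      (fun x => C * (((1 - x) / x) ^ γ * x ^ (p - 1))) ?_ ?_
      ((integrableOn_div_rpow hγ hγp).const_mul C) ?_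
    · refine Eventually.of_forall fun τ => Measurable.aestronglyMeasurable ?_
      have : Measurable fun x : ℝ => μ.real {y | f y < τ * ((1 - x) / x)} :=
        hmono.measurable.comp (by fun_prop)
      fun_prop
    · filter_upwards [self_mem_nhdsWithin] with τ hτ
      have hτ : 0 < τ := hτ
      refine (ae_restrict_iff' measurableSet_Ioo).2 (Eventually.of_forall fun x hx => ?_)
      have hw : 0 < (1 - x) / x := div_pos (sub_pos.2 hx.2) hx.1
      have hx0 := hx.1
      rw [Real.norm_of_nonneg (by positivity), ← mul_assoc]
      refine mul_le_mul_of_nonneg_right ?_ (by positivity)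
      calc τ ^ (-γ) * μ.real {y | f y < τ * ((1 - x) / x)}
          ≤ τ ^ (-γ) * (C * (τ * ((1 - x) / x)) ^ γ) := by
            gcongr
            exact hC _ (by positivity)
        _ = C * ((1 - x) / x) ^ γ := by
            rw [Real.mul_rpow hτ.le hw.le, mul_left_comm, ← mul_assoc (τ ^ (-γ)),
              ← Real.rpow_add hτ]
            simp
    · refine (ae_restrict_iff' measurableSet_Ioo).2 (Eventually.of_forall fun x hx => ?_)
      have hw : 0 < (1 - x) / x := div_pos (sub_pos.2 hx.2) hx.1
      rw [← mul_assoc]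
      refine Tendsto.mul_const _ ?_
      have hlim : Tendsto (fun τ : ℝ => τ * ((1 - x) / x)) (𝓝[>] 0) (𝓝[>] 0) := by
        refine tendsto_nhdsWithin_iff.2 ⟨?_, ?_⟩
        · have : Tendsto (fun τ : ℝ => τ * ((1 - x) / x)) (𝓝 0) (𝓝 (0 * ((1 - x) / x))) :=
            tendsto_id.mul_const _
          rw [zero_mul] at this
          exact this.mono_left nhdsWithin_le_nhds
        · filter_upwards [self_mem_nhdsWithin] with τ hτ
          exact mul_pos hτ hw
      refine ((h.comp hlim).mul_const (((1 - x) / x) ^ γ)).congr' ?_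
      filter_upwards [self_mem_nhdsWithin] with τ hτ
      have hτ : 0 < τ := hτ
      simp only [Function.comp_apply]
      rw [Real.mul_rpow hτ.le hw.le, Real.rpow_neg hw.le]
      have : ((1 - x) / x) ^ γ ≠ 0 := (Real.rpow_pos_of_pos hw _).ne'
      field_simp
  rw [integral_const_mul, setIntegral_div_rpow hγ hγp] at key
  have h2 := key.const_mul p
  rw [mul_left_comm] at h2
  refine h2.congr' ?_
  filter_upwards [self_mem_nhdsWithin] with τ hτ
  exact (rpow_mul_integral_stieltjes_eq hf hf0 hfin (hγ.trans hγp) hτ).symm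

lemma add_rpow_neg_le {p c s τ : ℝ} (hp : 0 < p) (hc : 0 < c) (hs : 0 ≤ s)
    (h : c * (s + 1) ≤ s + τ) : (s + τ) ^ (-p) ≤ c ^ (-p) * (s + 1) ^ (-p) := by
  rw [← Real.mul_rpow hc.le (by positivity)]
  exact Real.rpow_le_rpow_of_nonpos (by positivity) h (by linarith)

lemma integrable_add_rpow_neg (hf : Measurable f) (hf0 : ∀ x, 0 ≤ f x) {p τ : ℝ} (hp : 0 < p)
    (hint : Integrable (fun x => (f x + 1) ^ (-p)) μ) (hτ : 0 < τ) :
    Integrable (fun x => (f x + τ) ^ (-p)) μ := by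
  refine (hint.const_mul (min 1 τ ^ (-p))).mono'
    (Measurable.aestronglyMeasurable (by fun_prop)) (Eventually.of_forall fun x => ?_)
  have h0 := hf0 x
  rw [Real.norm_of_nonneg (by positivity)]
  refine add_rpow_neg_le hp (by positivity) h0 ?_
  have h1 : min 1 τ * f x ≤ 1 * f x := by gcongr; exact min_le_left _ _
  linarith [min_le_right 1 τ]

lemma measure_lt_ne_top_of_integrable (hf0 : ∀ x, 0 ≤ f x) {p : ℝ} (hp : 0 < p)
    (hint : Integrable (fun x => (f x + 1) ^ (-p)) μ) (v : ℝ) : μ {x | f x < v} ≠ ⊤ := by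
  rcases lt_or_ge 0 v with hv | hv
  · refine ne_top_of_le_ne_top
      (hint.measure_norm_ge_lt_top (Real.rpow_pos_of_pos (show 0 < v + 1 by linarith) (-p))).ne
      (measure_mono fun x (hx : f x < v) => ?_)
    have h0 := hf0 x
    change _ ≤ ‖_‖
    rw [Real.norm_of_nonneg (by positivity)]
    exact Real.rpow_le_rpow_of_nonpos (by positivity) (by linarith) (by linarith)
  · have : {x | f x < v} = ∅ :=
      Set.eq_empty_of_forall_notMem fun x hx => absurd (hv.trans (hf0 x)) (not_le.2 hx)
    simp [this]

/-- Abelian theorem for the generalized Stieltjes transform. -/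
theorem tendsto_rpow_mul_integral_stieltjes (hf : Measurable f) (hf0 : ∀ x, 0 ≤ f x)
    {p γ b : ℝ} (hγ : 0 < γ) (hγp : γ < p) (hint : Integrable (fun x => (f x + 1) ^ (-p)) μ)
    (h : Tendsto (fun v => v ^ (-γ) * μ.real {x | f x < v}) (𝓝[>] 0) (𝓝 b)) :
    Tendsto (fun τ => τ ^ (p - γ) * ∫ x, (f x + τ) ^ (-p) ∂μ) (𝓝[>] 0)
      (𝓝 (b * (p * ProbabilityTheory.beta (p - γ) (γ + 1)))) := by
  have hp := hγ.trans hγp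
  have hfin := measure_lt_ne_top_of_integrable hf0 hp hint
  -- The hypothesis bounds the distribution function only near 0. Restricting `μ` to `{f < δ}`
  -- freezes it beyond `δ`, which makes the bound global.
  obtain ⟨δ, hδ, hδ'⟩ := mem_nhdsGT_iff_exists_Ioc_subset.1
    (h.eventually_le_const (lt_add_one b))
  have hδ : 0 < δ := hδ
  have hset : MeasurableSet {x | f x < δ} := measurableSet_lt hf measurable_const
  have hrestr (v : ℝ) : (μ.restrict {x | f x < δ}).real {x | f x < v} =
      μ.real {x | f x < min v δ} := by
    rw [measureReal_restrict_apply (measurableSet_lt hf measurable_const)]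
    congr 1
    ext x
    simp
  have hb1 : 0 ≤ b + 1 := le_trans (by positivity) (hδ' (Set.right_mem_Ioc.2 hδ))
  have hnear := tendsto_rpow_mul_integral_stieltjes_of_le (μ := μ.restrict {x | f x < δ})
    (C := b + 1) hf hf0 hγ hγp
    (fun v => ne_top_of_le_ne_top (hfin v) (Measure.restrict_apply_le _ _))
    (fun v hv => by
      rw [hrestr]
      have hm : 0 < min v δ := lt_min hv hδ
      have h1 : min v δ ^ (-γ) * μ.real {x | f x < min v δ} ≤ b + 1 :=
        hδ' ⟨hm, min_le_right _ _⟩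
      rw [Real.rpow_neg hm.le, inv_mul_le_iff₀ (by positivity), mul_comm] at h1
      refine h1.trans ?_
      gcongr
      exact min_le_left _ _)
    (h.congr' (by
      filter_upwards [Ioc_mem_nhdsGT hδ] with v hv
      rw [hrestr, min_eq_left hv.2]))
  have hfar : Tendsto (fun τ => τ ^ (p - γ) * ∫ x in {x | f x < δ}ᶜ, (f x + τ) ^ (-p) ∂μ)
      (𝓝[>] 0) (𝓝 0) := by
    -- For `f ≥ δ` this constant gives `c (f + 1) ≤ f ≤ f + τ`, so the far integral is bounded
    -- independently of `τ` and is killed by `τ ^ (p - γ)`.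
    set c := δ / (1 + δ)
    have hc : 0 < c := by positivity
    set K := ∫ x in {x | f x < δ}ᶜ, c ^ (-p) * (f x + 1) ^ (-p) ∂μ
    have hlim : Tendsto (fun τ : ℝ => τ ^ (p - γ) * K) (𝓝[>] 0) (𝓝 0) := by
      have h0 : Tendsto (fun τ : ℝ => τ ^ (p - γ)) (𝓝 0) (𝓝 (0 ^ (p - γ))) :=
        Real.continuousAt_rpow_const 0 (p - γ) (Or.inr (by linarith))
      have h1 := (h0.mono_left (nhdsWithin_le_nhds (s := Set.Ioi 0))).mul_const K
      rwa [Real.zero_rpow (by linarith), zero_mul] at h1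
    refine squeeze_zero' ?_ ?_ hlim
    · filter_upwards [self_mem_nhdsWithin] with τ hτ
      have hτ : 0 < τ := hτ
      refine mul_nonneg (by positivity) (integral_nonneg fun x => ?_)
      have := hf0 x
      simp only [Pi.zero_apply]
      positivity
    · filter_upwards [self_mem_nhdsWithin] with τ hτ
      have hτ : 0 < τ := hτ
      refine mul_le_mul_of_nonneg_left (setIntegral_mono_on
        (integrable_add_rpow_neg hf hf0 hp hint hτ).integrableOn
        (hint.const_mul _).integrableOn hset.compl fun x hx => ?_) (by positivity)
      have hx : δ ≤ f x := not_lt.1 hx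
      refine add_rpow_neg_le hp hc (hf0 x) ?_
      rw [div_mul_eq_mul_div, div_le_iff₀ (by positivity)]
      nlinarith [hf0 x]
  have := hnear.add hfar
  rw [add_zero] at this
  refine this.congr' ?_
  filter_upwards [self_mem_nhdsWithin] with τ hτ
  rw [← mul_add, integral_add_compl hset (integrable_add_rpow_neg hf hf0 hp hint hτ)]

end Stieltjes

/-! ### Tauberian theorem for the Stieltjes transform -/

section Stieltjes

variable {X : Type*} [MeasurableSpace X] {μ : Measure X} {f : X → ℝ}

/-- The map `x ↦ τ / (f x + τ)` into the unit interval. -/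
noncomputable def unitRatio (f : X → ℝ) (hf0 : ∀ x, 0 ≤ f x) (τ : ℝ) (hτ : 0 < τ) (x : X) :
    unitInterval :=
  ⟨τ / (f x + τ), by have := hf0 x; positivity,
    (div_le_one (by linarith [hf0 x])).2 (by linarith [hf0 x])⟩

lemma measurable_unitRatio (hf : Measurable f) (hf0 : ∀ x, 0 ≤ f x) {τ : ℝ} (hτ : 0 < τ) :
    Measurable (unitRatio f hf0 τ hτ) :=
  Measurable.subtype_mk (by fun_prop)

lemma integrable_comp_unitRatio_mul (hf : Measurable f) (hf0 : ∀ x, 0 ≤ f x) {p τ : ℝ}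
    (hτ : 0 < τ) (hint : Integrable (fun x => (f x + τ) ^ (-p)) μ) (g : C(unitInterval, ℝ)) :
    Integrable (fun x => g (unitRatio f hf0 τ hτ x) * (f x + τ) ^ (-p)) μ :=
  hint.bdd_mul (c := ‖g‖)
    (g.continuous.measurable.comp (measurable_unitRatio hf hf0 hτ)).aestronglyMeasurable
    (Eventually.of_forall fun _ => g.norm_coe_le_norm _)

/-- The positive functional `g ↦ c ∫ g (τ / (f + τ)) (f + τ) ^ (-p) ∂μ` on `C([0, 1])`. -/
noncomputable def stieltjesFunctional (hf : Measurable f) (hf0 : ∀ x, 0 ≤ f x) {p τ : ℝ}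
    (hτ : 0 < τ) (hint : Integrable (fun x => (f x + τ) ^ (-p)) μ) (c : ℝ) :
    C(unitInterval, ℝ) →ₗ[ℝ] ℝ where
  toFun g := c * ∫ x, g (unitRatio f hf0 τ hτ x) * (f x + τ) ^ (-p) ∂μ
  map_add' g h := by
    simp only [ContinuousMap.add_apply, add_mul]
    rw [integral_add (integrable_comp_unitRatio_mul hf hf0 hτ hint g)
      (integrable_comp_unitRatio_mul hf hf0 hτ hint h), mul_add]
  map_smul' a g := by
    simp only [ContinuousMap.smul_apply, smul_eq_mul, mul_assoc, RingHom.id_apply]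
    rw [integral_const_mul, mul_left_comm]

lemma stieltjesFunctional_nonneg (hf : Measurable f) (hf0 : ∀ x, 0 ≤ f x) {p τ : ℝ}
    (hτ : 0 < τ) (hint : Integrable (fun x => (f x + τ) ^ (-p)) μ) {c : ℝ} (hc : 0 ≤ c)
    (g : C(unitInterval, ℝ)) (hg : 0 ≤ g) : 0 ≤ stieltjesFunctional hf hf0 hτ hint c g := by
  refine mul_nonneg hc (integral_nonneg fun x => mul_nonneg (hg _) ?_)
  have := hf0 x
  positivity

/-- With `x = τ / (f + τ)` one has `f + e ^ y τ = (f + τ) (1 - x + e ^ y x)`: rescaling `τ` amounts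
to changing the test function. -/
lemma stieltjesFunctional_stieltjesCurve (hf : Measurable f) (hf0 : ∀ x, 0 ≤ f x) {p τ : ℝ}
    (hτ : 0 < τ) (hint : Integrable (fun x => (f x + τ) ^ (-p)) μ) (c y : ℝ) :
    stieltjesFunctional hf hf0 hτ hint c (stieltjesCurve p 0 y) =
      c * ∫ x, (f x + Real.exp y * τ) ^ (-p) ∂μ := by
  change c * _ = _
  congr 2
  ext x
  have h0 := hf0 x
  have hpos : 0 < f x + τ := by linarith
  simp only [stieltjesCurve, unitRatio, ContinuousMap.coe_mk, pow_zero, one_mul, Nat.cast_zero,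
    sub_zero]
  rw [← Real.mul_rpow _ hpos.le]
  · congr 1
    field_simp
    ring
  · exact (one_sub_add_mul_pos (unitRatio f hf0 τ hτ x).2 (Real.exp_pos y)).le

/-- A nonnegative function on the unit interval that vanishes on `[0, a]`, equals `x ^ (-p)` on
`[b, 1]` and is bounded by `x ^ (-p)` in between. -/
structure IsRpowCutoff (p a b : ℝ) (g : C(unitInterval, ℝ)) : Prop where
  nonneg : 0 ≤ g
  eq_rpow : ∀ x : unitInterval, b ≤ (x : ℝ) → g x = (x : ℝ) ^ (-p)
  eq_zero : ∀ x : unitInterval, (x : ℝ) ≤ a → g x = 0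
  le_rpow : ∀ x : unitInterval, a < (x : ℝ) → g x ≤ (x : ℝ) ^ (-p)

lemma exists_isRpowCutoff (p : ℝ) {a b : ℝ} (ha : 0 < a) (hab : a < b) :
    ∃ g : C(unitInterval, ℝ), IsRpowCutoff p a b g := by
  have hb : 0 < b - a := sub_pos.2 hab
  have hm (x : ℝ) : 0 < max x a := ha.trans_le (le_max_right _ _)
  -- A linear ramp from `a` to `b` times `x ^ (-p)`; replacing `x` by `max x a` removes the
  -- singularity at 0 and changes nothing where the ramp is nonzero.
  refine ⟨⟨fun x => max (x : ℝ) a ^ (-p) * max 0 (min 1 (((x : ℝ) - a) / (b - a))), ?_⟩,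
    fun x => ?_, fun x hx => ?_, fun x hx => ?_, fun x hx => ?_⟩
  · exact (Continuous.rpow_const (by fun_prop) fun x => Or.inl (hm _).ne').mul (by fun_prop)
  · have := hm x
    change 0 ≤ _ * _
    positivity
  · have h1 : 1 ≤ ((x : ℝ) - a) / (b - a) := (one_le_div hb).2 (by linarith)
    simp only [ContinuousMap.coe_mk]
    rw [max_eq_left (hab.le.trans hx), min_eq_left h1, max_eq_right zero_le_one, mul_one]
  · have h1 : ((x : ℝ) - a) / (b - a) ≤ 0 := div_nonpos_of_nonpos_of_nonneg (by linarith) hb.le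
    simp only [ContinuousMap.coe_mk]
    rw [max_eq_left ((min_le_right _ _).trans h1), mul_zero]
  · simp only [ContinuousMap.coe_mk]
    rw [max_eq_left hx.le]
    have : 0 < (x : ℝ) := ha.trans hx
    exact mul_le_of_le_one_right (by positivity) (max_le zero_le_one (min_le_left _ _))

lemma rpow_neg_unitRatio_mul {X : Type*} {f : X → ℝ} (hf0 : ∀ x, 0 ≤ f x) {p τ : ℝ} (hτ : 0 < τ) (x : X) :
    (unitRatio f hf0 τ hτ x : ℝ) ^ (-p) * (f x + τ) ^ (-p) = τ ^ (-p) := by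
  have hpos : 0 < f x + τ := by linarith [hf0 x]
  rw [← Real.mul_rpow (unitRatio f hf0 τ hτ x).2.1 hpos.le]
  simp only [unitRatio]
  rw [div_mul_cancel₀ _ hpos.ne']

/-- Since `f < v τ` means `x > 1 / (1 + v)`, and `x ^ (-p)` turns the weight `(f + τ) ^ (-p)` into
the constant `τ ^ (-p)`, the cutoff integrand lies between two multiples of indicators. -/
lemma distribution_le_stieltjesFunctional_le {p v w τ c : ℝ} {g : C(unitInterval, ℝ)}
    (hg : IsRpowCutoff p (1 / (1 + w)) (1 / (1 + v)) g) (hv : 0 < v) (hw : 0 < w)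
    (hf : Measurable f) (hf0 : ∀ x, 0 ≤ f x) (hτ : 0 < τ)
    (hint : Integrable (fun x => (f x + τ) ^ (-p)) μ) (hfin : ∀ v, μ {x | f x < v} ≠ ⊤)
    (hc : 0 ≤ c) :
    c * (τ ^ (-p) * μ.real {x | f x < v * τ}) ≤ stieltjesFunctional hf hf0 hτ hint c g ∧
      stieltjesFunctional hf hf0 hτ hint c g ≤ c * (τ ^ (-p) * μ.real {x | f x < w * τ}) := by
  have hmeas (v : ℝ) : MeasurableSet {x | f x < v} := measurableSet_lt hf measurable_const
  have hind (v : ℝ) : τ ^ (-p) * μ.real {x | f x < v} =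
      ∫ x, {x | f x < v}.indicator (fun _ => τ ^ (-p)) x ∂μ := by
    rw [integral_indicator (hmeas v), setIntegral_const, smul_eq_mul, mul_comm]
  have hindint (v : ℝ) : Integrable ({x | f x < v}.indicator fun _ => τ ^ (-p)) μ :=
    (integrable_indicator_iff (hmeas v)).2 (integrableOn_const (hfin v))
  have hlt (x : X) (v : ℝ) (hv : 0 < v) :
      1 / (1 + v) < (unitRatio f hf0 τ hτ x : ℝ) ↔ f x < v * τ := by
    simp only [unitRatio]
    rw [div_lt_div_iff₀ (by positivity) (by linarith [hf0 x])]
    constructor <;> intro h <;> linarith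
  have hgint := integrable_comp_unitRatio_mul hf hf0 hτ hint g
  rw [hind, hind]
  constructor
  · refine mul_le_mul_of_nonneg_left (integral_mono (hindint _) hgint fun x => ?_) hc
    by_cases hx : f x < v * τ
    · rw [Set.indicator_of_mem (show x ∈ {x | f x < v * τ} from hx)]
      simp only
      rw [hg.eq_rpow _ ((hlt x v hv).2 hx).le, rpow_neg_unitRatio_mul]
    · rw [Set.indicator_of_notMem (show x ∉ {x | f x < v * τ} from hx)]
      have := hf0 x
      exact mul_nonneg (hg.nonneg _) (by positivity)
  · refine mul_le_mul_of_nonneg_left (integral_mono hgint (hindint _) fun x => ?_) hc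
    by_cases hx : f x < w * τ
    · rw [Set.indicator_of_mem (show x ∈ {x | f x < w * τ} from hx), ← rpow_neg_unitRatio_mul hf0 hτ x]
      have := hf0 x
      exact mul_le_mul_of_nonneg_right (hg.le_rpow _ ((hlt x w hw).2 hx)) (by positivity)
    · rw [Set.indicator_of_notMem (show x ∉ {x | f x < w * τ} from hx)]
      simp only
      rw [hg.eq_zero _ (not_lt.1 fun h => hx ((hlt x w hw).1 h)), zero_mul]

lemma volume_restrict_Ioi_abs_rpow_lt {γ v : ℝ} (hγ : 0 < γ) (hv : 0 < v) :
    (volume.restrict (Set.Ioi (0 : ℝ))) {s | |s| ^ γ⁻¹ < v} = ENNReal.ofReal (v ^ γ) := by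
  have hset : {s : ℝ | |s| ^ γ⁻¹ < v} ∩ Set.Ioi 0 = Set.Ioo 0 (v ^ γ) := by
    ext s
    simp only [Set.mem_inter_iff, Set.mem_ofPred_eq, Set.mem_Ioi, Set.mem_Ioo]
    rw [and_comm]
    refine and_congr_right fun hs => ?_
    rw [abs_of_pos hs, Real.rpow_inv_lt_iff_of_pos hs.le hv.le hγ]
  rw [Measure.restrict_apply' measurableSet_Ioi, hset, Real.volume_Ioo, sub_zero]

end Stieltjes

/-- Tauberian theorem for the generalized Stieltjes transform. -/
theorem tendsto_rpow_mul_measureReal_of_stieltjes {X : Type*} [MeasurableSpace X] {μ : Measure X}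
    {f : X → ℝ} (hf : Measurable f) (hf0 : ∀ x, 0 ≤ f x)
    {p γ a : ℝ} (hγ : 0 < γ) (hγp : γ < p) (hint : Integrable (fun x => (f x + 1) ^ (-p)) μ)
    (h : Tendsto (fun τ => τ ^ (p - γ) * ∫ x, (f x + τ) ^ (-p) ∂μ) (𝓝[>] 0) (𝓝 a)) :
    Tendsto (fun v => v ^ (-γ) * μ.real {x | f x < v}) (𝓝[>] 0)
      (𝓝 (a / (p * ProbabilityTheory.beta (p - γ) (γ + 1)))) := by
  have hp := hγ.trans hγp
  have hfin := measure_lt_ne_top_of_integrable hf0 hp hint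
  set κ := p * ProbabilityTheory.beta (p - γ) (γ + 1)
  have hκ : 0 < κ := mul_pos hp (ProbabilityTheory.beta_pos (by linarith) (by linarith))
  -- The model: Lebesgue measure on `(0, ∞)` with `f' s = s ^ (1 / γ)` has distribution function `v
  -- ^ γ`, and its normalized transform is `κ` for every `τ`. The absolute value only serves to make
  -- `f'` nonnegative on all of `ℝ`.
  set f' : ℝ → ℝ := fun s => |s| ^ γ⁻¹
  set m : Measure ℝ := volume.restrict (Set.Ioi 0)
  have hf' : Measurable f' := by fun_prop
  have hf'0 (s : ℝ) : 0 ≤ f' s := by positivity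
  have hm (v : ℝ) (hv : 0 < v) : m {s | f' s < v} = ENNReal.ofReal (v ^ γ) :=
    volume_restrict_Ioi_abs_rpow_lt hγ hv
  have hm' (v : ℝ) (hv : 0 < v) : m.real {s | f' s < v} = v ^ γ := by
    rw [measureReal_def, hm v hv, ENNReal.toReal_ofReal (by positivity)]
  have hmS (τ : ℝ) (hτ : 0 < τ) : τ ^ (p - γ) * ∫ s, (f' s + τ) ^ (-p) ∂m = κ :=
    rpow_mul_integral_stieltjes_of_eq_rpow hf' hf'0 hγ hγp hm hτ
  have hmint : Integrable (fun s => (f' s + 1) ^ (-p)) m := by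
    refine Integrable.of_integral_ne_zero fun h0 => hκ.ne ?_
    rw [← hmS 1 one_pos, h0, mul_zero]
  have hmfin := measure_lt_ne_top_of_integrable hf'0 hp hmint
  have ha : 0 ≤ a := by
    refine ge_of_tendsto h ?_
    filter_upwards [self_mem_nhdsWithin] with τ hτ
    have hτ : 0 < τ := hτ
    refine mul_nonneg (by positivity) (integral_nonneg fun x => ?_)
    have := hf0 x
    simp only [Pi.zero_apply]
    positivity
  have haκ : 0 ≤ a / κ := by positivity
  -- Here `τ = e ^ z` with `z → -∞`. The limit `Ψ` is the model functional at `τ = 1`, scaled by `a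
  -- / κ` to match the limit `a`.
  set Φ : ℝ → C(unitInterval, ℝ) →ₗ[ℝ] ℝ := fun z => stieltjesFunctional hf hf0 (Real.exp_pos z)
    (integrable_add_rpow_neg hf hf0 hp hint (Real.exp_pos z)) (Real.exp z ^ (p - γ))
  set Ψ : C(unitInterval, ℝ) →ₗ[ℝ] ℝ := stieltjesFunctional hf' hf'0 one_pos hmint (a / κ)
  have hconv : ∀ g, Tendsto (fun z => Φ z g) atBot (𝓝 (Ψ g)) := by
    refine tendsto_of_tendsto_stieltjesCurve hp
      (fun z => stieltjesFunctional_nonneg hf hf0 _ _ (by positivity))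
      (stieltjesFunctional_nonneg hf' hf'0 _ _ haκ) fun y => ?_
    -- On the kernel with parameter `y`, both functionals carry the factor `e ^ (-y (p - γ))`; what
    -- remains is the hypothesis at `τ = e ^ (y + z)`.
    have hΨ : Ψ (stieltjesCurve p 0 y) = (Real.exp y ^ (p - γ))⁻¹ * a := by
      have hS := hmS (Real.exp y) (Real.exp_pos y)
      have hne : Real.exp y ^ (p - γ) ≠ 0 := by positivity
      simp only [Ψ, stieltjesFunctional_stieltjesCurve, mul_one]
      rw [← hS] at hκ ⊢
      have hI := right_ne_zero_of_mul hκ.ne'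
      field_simp
    have hlim : Tendsto (fun z => Real.exp y * Real.exp z) atBot (𝓝[>] 0) := by
      have : Tendsto (fun z => Real.exp (y + z)) atBot (𝓝[>] 0) :=
        Real.tendsto_exp_atBot_nhdsGT.comp (tendsto_atBot_add_const_left _ _ tendsto_id)
      simpa only [Real.exp_add] using this
    rw [hΨ]
    refine ((h.comp hlim).const_mul ((Real.exp y ^ (p - γ))⁻¹)).congr fun z => ?_
    simp only [Φ, stieltjesFunctional_stieltjesCurve, Function.comp_apply]
    rw [Real.mul_rpow (Real.exp_pos y).le (Real.exp_pos z).le]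
    have hne : Real.exp y ^ (p - γ) ≠ 0 := by positivity
    field_simp
  rw [← Real.tendsto_comp_exp_atBot]
  have hscale (z : ℝ) (t : ℝ) : Real.exp z ^ (p - γ) * (Real.exp z ^ (-p) * t) =
      Real.exp z ^ (-γ) * t := by
    rw [← mul_assoc, ← Real.rpow_add (Real.exp_pos z)]
    ring_nf
  have hpow : ContinuousAt (fun r : ℝ => a / κ * r ^ γ) 1 :=
    continuousAt_const.mul (Real.continuousAt_rpow_const 1 γ (Or.inl one_ne_zero))
  have hpow1 : a / κ * (1 : ℝ) ^ γ = a / κ := by simp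
  refine tendsto_order.2 ⟨fun c hc => ?_, fun c hc => ?_⟩
  -- Lower bound: choose `r < 1` with `c < (a / κ) r ^ γ`. A cutoff between levels `r` and 1 has `Ψ
  -- g ≥ (a / κ) r ^ γ`, while `Φ z g` is at most the normalized distribution at `e ^ z`. The upper
  -- bound mirrors this with `r > 1`.
  · have h1 : ∀ᶠ r in 𝓝[<] (1 : ℝ), c < a / κ * r ^ γ :=
      (hpow.tendsto.eventually_const_lt (hpow1.symm ▸ hc)).filter_mono nhdsWithin_le_nhds
    obtain ⟨r, hr, hr0, hr1⟩ := (h1.and (Ioo_mem_nhdsLT (zero_lt_one' ℝ))).exists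
    obtain ⟨g, hg⟩ := exists_isRpowCutoff p (a := 1 / (1 + 1)) (b := 1 / (1 + r)) (by norm_num)
      (by gcongr)
    have hΨg := (distribution_le_stieltjesFunctional_le hg hr0 one_pos hf' hf'0 one_pos hmint hmfin haκ).1
    rw [mul_one, hm' r hr0, Real.one_rpow, one_mul] at hΨg
    filter_upwards [(hconv g).eventually_const_lt (hr.trans_le hΨg)] with z hz
    have := (distribution_le_stieltjesFunctional_le hg hr0 one_pos hf hf0 (Real.exp_pos z) (integrable_add_rpow_neg hf hf0 hp hint (Real.exp_pos z))
      hfin (c := Real.exp z ^ (p - γ)) (by positivity)).2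
    rw [one_mul, hscale] at this
    exact hz.trans_le this
  · have h1 : ∀ᶠ r in 𝓝[>] (1 : ℝ), a / κ * r ^ γ < c :=
      (hpow.tendsto.eventually_lt_const (hpow1.symm ▸ hc)).filter_mono nhdsWithin_le_nhds
    obtain ⟨r, hr, hr1⟩ := (h1.and self_mem_nhdsWithin).exists
    have hr1 : 1 < r := hr1
    obtain ⟨g, hg⟩ := exists_isRpowCutoff p (a := 1 / (1 + r)) (b := 1 / (1 + 1)) (by positivity)
      (by gcongr)
    have hΨg := (distribution_le_stieltjesFunctional_le hg one_pos (one_pos.trans hr1) hf' hf'0 one_pos hmint hmfin haκ).2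
    rw [mul_one, hm' r (by positivity), Real.one_rpow, one_mul] at hΨg
    filter_upwards [(hconv g).eventually_lt_const (hΨg.trans_lt hr)] with z hz
    have := (distribution_le_stieltjesFunctional_le hg one_pos (one_pos.trans hr1) hf hf0 (Real.exp_pos z) (integrable_add_rpow_neg hf hf0 hp hint (Real.exp_pos z))
      hfin (c := Real.exp z ^ (p - γ)) (by positivity)).1
    rw [one_mul, hscale] at this
    exact this.trans_lt hz

/-! ### Reduction of the half-space problem to the Stieltjes transform -/

lemma tendsto_sq_nhdsGT_zero : Tendsto (fun t : ℝ => t ^ 2) (𝓝[>] 0) (𝓝[>] 0) := by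
  refine tendsto_nhdsWithin_iff.2 ⟨?_, ?_⟩
  · have : Tendsto (fun t : ℝ => t ^ 2) (𝓝 0) (𝓝 (0 ^ 2)) := (continuous_pow 2).tendsto 0
    rw [zero_pow two_ne_zero] at this
    exact this.mono_left nhdsWithin_le_nhds
  · filter_upwards [self_mem_nhdsWithin] with t ht
    have ht : 0 < t := ht
    exact pow_pos ht 2

lemma tendsto_sqrt_nhdsGT_zero : Tendsto Real.sqrt (𝓝[>] 0) (𝓝[>] 0) := by
  refine tendsto_nhdsWithin_iff.2 ⟨?_, ?_⟩
  · have := Real.continuous_sqrt.tendsto 0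
    rw [Real.sqrt_zero] at this
    exact this.mono_left nhdsWithin_le_nhds
  · filter_upwards [self_mem_nhdsWithin] with t ht
    exact Real.sqrt_pos.2 ht

lemma tendsto_comp_sq_nhdsGT_zero {F : ℝ → ℝ} {l : Filter ℝ} :
    Tendsto (fun t : ℝ => F (t ^ 2)) (𝓝[>] 0) l ↔ Tendsto F (𝓝[>] 0) l := by
  refine ⟨fun h => (h.comp tendsto_sqrt_nhdsGT_zero).congr' ?_,
    fun h => h.comp tendsto_sq_nhdsGT_zero⟩
  filter_upwards [self_mem_nhdsWithin] with t ht
  have ht : 0 < t := ht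
  simp [Real.sq_sqrt ht.le]

lemma IsBoundaryMeasure.integrable_rpow_neg {n : ℕ} {u : ProdSpace n → ℝ}
    {μ : Measure (EuclideanSpace ℝ (Fin (n - 1)))} (hμ : IsBoundaryMeasure n u μ) :
    Integrable (fun x => (‖x‖ ^ 2 + 1) ^ (-((n : ℝ) / 2))) μ := by
  refine hμ.integrable.congr (Eventually.of_forall fun x => ?_)
  simp only
  rw [Real.rpow_neg (by positivity), one_div]

lemma measureReal_ball_div_rpow_mul_rpow {n : ℕ} (μ : Measure (EuclideanSpace ℝ (Fin (n - 1))))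
    (α : ℝ) {r : ℝ} (hr : 0 < r) :
    (μ (Metric.ball 0 r)).toReal / r ^ ((n : ℝ) - 1) * r ^ α =
      (r ^ 2) ^ (-(((n : ℝ) - 1 - α) / 2)) * μ.real {x | ‖x‖ ^ 2 < r ^ 2} := by
  have hball : Metric.ball (0 : EuclideanSpace ℝ (Fin (n - 1))) r = {x | ‖x‖ ^ 2 < r ^ 2} := by
    ext x
    rw [mem_ball_zero_iff]
    exact (pow_lt_pow_iff_left₀ (norm_nonneg x) hr.le two_ne_zero).symm
  rw [← hball, measureReal_def, ← Real.rpow_natCast r 2, ← Real.rpow_mul hr.le,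
    div_mul_eq_mul_div, mul_div_assoc, ← Real.rpow_sub hr, mul_comm]
  congr 2
  push_cast
  ring

lemma boundary_representation_zero {n : ℕ} {u : ProdSpace n → ℝ}
    {μ : Measure (EuclideanSpace ℝ (Fin (n - 1)))} {C : ℝ}
    (hC : ∀ (x : EuclideanSpace ℝ (Fin (n - 1))) (t : ℝ), 0 < t →
      u (point x t) = C * t + ∫ ξ, halfSpacePoissonKernel n (x - ξ) t ∂μ)
    (α : ℝ) {t : ℝ} (ht : 0 < t) :
    u (point 0 t) * t ^ α = C * t ^ (α + 1) +
      Real.Gamma ((n : ℝ) / 2) / Real.pi ^ ((n : ℝ) / 2) *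
        ((t ^ 2) ^ ((n : ℝ) / 2 - ((n : ℝ) - 1 - α) / 2) *
          ∫ ξ, (‖ξ‖ ^ 2 + t ^ 2) ^ (-((n : ℝ) / 2)) ∂μ) := by
  have hint : ∫ ξ, halfSpacePoissonKernel n (0 - ξ) t ∂μ =
      Real.Gamma ((n : ℝ) / 2) / Real.pi ^ ((n : ℝ) / 2) * t *
        ∫ ξ, (‖ξ‖ ^ 2 + t ^ 2) ^ (-((n : ℝ) / 2)) ∂μ := by
    rw [← integral_const_mul]
    congr 1
    ext ξ
    rw [halfSpacePoissonKernel, zero_sub, norm_neg, Real.rpow_neg (by positivity), div_eq_mul_inv]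
  have hpow : (t ^ 2) ^ ((n : ℝ) / 2 - ((n : ℝ) - 1 - α) / 2) = t ^ (α + 1) := by
    rw [← Real.rpow_natCast t 2, ← Real.rpow_mul ht.le]
    congr 1
    push_cast
    ring
  rw [hC 0 t ht, hint, hpow, Real.rpow_add_one ht.ne']
  ring

/-- The linear term `C t ^ (α + 1)` vanishes in the limit because `α > -1`, and the Poisson constant
is nonzero, so it can be divided out. -/
lemma tendsto_boundary_iff {n : ℕ} {u : ProdSpace n → ℝ}
    {μ : Measure (EuclideanSpace ℝ (Fin (n - 1)))} (hμ : IsBoundaryMeasure n u μ)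
    {α : ℝ} (hα : -1 < α) {c : ℝ} (hn : 0 < n) :
    Tendsto (fun t : ℝ => u (point 0 t) * t ^ α) (𝓝[>] 0)
      (𝓝 (Real.Gamma ((n : ℝ) / 2) / Real.pi ^ ((n : ℝ) / 2) * c)) ↔
    Tendsto (fun τ : ℝ => τ ^ ((n : ℝ) / 2 - ((n : ℝ) - 1 - α) / 2) *
          ∫ ξ, (‖ξ‖ ^ 2 + τ) ^ (-((n : ℝ) / 2)) ∂μ) (𝓝[>] 0) (𝓝 c) := by
  obtain ⟨C, -, hC⟩ := hμ.representation
  set k := Real.Gamma ((n : ℝ) / 2) / Real.pi ^ ((n : ℝ) / 2)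
  have hk : k ≠ 0 := by
    have : 0 < Real.Gamma ((n : ℝ) / 2) := Real.Gamma_pos_of_pos (by positivity)
    positivity
  have hlin : Tendsto (fun t : ℝ => C * t ^ (α + 1)) (𝓝[>] 0) (𝓝 0) := by
    have h0 : Tendsto (fun t : ℝ => t ^ (α + 1)) (𝓝 0) (𝓝 (0 ^ (α + 1))) :=
      Real.continuousAt_rpow_const 0 (α + 1) (Or.inr (by linarith))
    have h1 := (h0.mono_left (nhdsWithin_le_nhds (s := Set.Ioi 0))).const_mul C
    rwa [Real.zero_rpow (by linarith), mul_zero] at h1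
  have heq := fun (t : ℝ) (ht : t ∈ Set.Ioi (0 : ℝ)) => boundary_representation_zero hC α ht
  refine Iff.trans ?_ tendsto_comp_sq_nhdsGT_zero
  constructor
  · intro h
    have h2 := (h.sub hlin).const_mul k⁻¹
    rw [sub_zero, inv_mul_cancel_left₀ hk] at h2
    refine h2.congr' ?_
    filter_upwards [self_mem_nhdsWithin] with t ht
    rw [heq t ht, add_sub_cancel_left, inv_mul_cancel_left₀ hk]
  · intro h
    have h2 := hlin.add (h.const_mul k)
    rw [zero_add] at h2
    refine h2.congr' ?_
    filter_upwards [self_mem_nhdsWithin] with t ht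
    rw [heq t ht]

theorem tendsto_boundary_iff_tendsto_ball {n : ℕ} (hn : 2 ≤ n) {u : ProdSpace n → ℝ}
    {μ : Measure (EuclideanSpace ℝ (Fin (n - 1)))} (hμ : IsBoundaryMeasure n u μ)
    {α : ℝ} (hα : -1 < α) (hα' : α < (n : ℝ) - 1) (b : ℝ) :
    Tendsto (fun t : ℝ => u (point 0 t) * t ^ α) (𝓝[>] 0)
      (𝓝 (b * (Real.Gamma (((n : ℝ) - α + 1) / 2) * Real.Gamma ((α + 1) / 2) /
        Real.pi ^ ((n : ℝ) / 2)))) ↔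
    Tendsto (fun r : ℝ => (μ (Metric.ball 0 r)).toReal / r ^ ((n : ℝ) - 1) * r ^ α)
      (𝓝[>] 0) (𝓝 b) := by
  have hp : 0 < (n : ℝ) / 2 := by positivity
  set p := (n : ℝ) / 2 with hp_def
  set γ := ((n : ℝ) - 1 - α) / 2 with hγ_def
  -- The two bounds on `α` are exactly `0 < γ` (from `α < n - 1`) and `γ < p` (from `-1 < α`).
  have hγ : 0 < γ := by simp only [hγ_def]; linarith
  have hγp : γ < p := by simp only [hγ_def, hp_def]; linarith
  set κ := p * ProbabilityTheory.beta (p - γ) (γ + 1) with hκ_def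
  have hκ : 0 < κ := mul_pos hp (ProbabilityTheory.beta_pos (by linarith) (by linarith))
  -- The denominator of the Beta value is `Γ(p + 1) = p Γ(p)`, which cancels both the `p` in `κ` and
  -- the `Γ(n / 2)` of the Poisson kernel.
  have hconst : b * (Real.Gamma (((n : ℝ) - α + 1) / 2) * Real.Gamma ((α + 1) / 2) /
      Real.pi ^ p) = Real.Gamma p / Real.pi ^ p * (b * κ) := by
    rw [hκ_def, ProbabilityTheory.beta, show p - γ + (γ + 1) = p + 1 by ring,
      Real.Gamma_add_one hp.ne', show ((n : ℝ) - α + 1) / 2 = γ + 1 by rw [hγ_def]; ring,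
      show (α + 1) / 2 = p - γ by rw [hγ_def, hp_def]; ring]
    have := (Real.Gamma_pos_of_pos hp).ne'
    field_simp
  have hf : Measurable fun x : EuclideanSpace ℝ (Fin (n - 1)) => ‖x‖ ^ 2 := by fun_prop
  have hf0 (x : EuclideanSpace ℝ (Fin (n - 1))) : 0 ≤ ‖x‖ ^ 2 := by positivity
  have hball : Tendsto (fun r : ℝ => (μ (Metric.ball 0 r)).toReal / r ^ ((n : ℝ) - 1) * r ^ α)
      (𝓝[>] 0) (𝓝 b) ↔
      Tendsto (fun v => v ^ (-γ) * μ.real {x | ‖x‖ ^ 2 < v}) (𝓝[>] 0) (𝓝 b) := by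
    refine Iff.trans ?_ tendsto_comp_sq_nhdsGT_zero
    refine tendsto_congr' ?_
    filter_upwards [self_mem_nhdsWithin] with r hr
    exact measureReal_ball_div_rpow_mul_rpow μ α hr
  rw [hconst, tendsto_boundary_iff hμ hα (by omega), hball]
  constructor
  · intro h
    have := tendsto_rpow_mul_measureReal_of_stieltjes hf hf0 hγ hγp hμ.integrable_rpow_neg h
    rwa [mul_div_cancel_right₀ _ hκ.ne'] at this
  · exact tendsto_rpow_mul_integral_stieltjes hf hf0 hγ hγp hμ.integrable_rpow_neg

theorem mainTheorem1 (n : ℕ) (hn : 2 ≤ n) (u : ProdSpace n → ℝ) (hu : IsPositiveHarmonic n u)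
    (μ : Measure (EuclideanSpace ℝ (Fin (n - 1)))) (hμ : IsBoundaryMeasure n u μ)
    (α : ℝ) (hα : -1 < α) (hα' : α < (n : ℝ) - 1) :
    ((∃ a : ℝ, 0 ≤ a ∧
        Tendsto (fun t : ℝ => u (point 0 t) * t ^ α) (𝓝[>] 0) (𝓝 a)) ↔
      (∃ b : ℝ, 0 ≤ b ∧
        Tendsto (fun r : ℝ => (μ (Metric.ball 0 r)).toReal / r ^ ((n : ℝ) - 1) * r ^ α)
          (𝓝[>] 0) (𝓝 b))) ∧
    (∀ a b : ℝ,
      Tendsto (fun t : ℝ => u (point 0 t) * t ^ α) (𝓝[>] 0) (𝓝 a) →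
      Tendsto (fun r : ℝ => (μ (Metric.ball 0 r)).toReal / r ^ ((n : ℝ) - 1) * r ^ α)
        (𝓝[>] 0) (𝓝 b) →
      a = b * (Real.Gamma (((n : ℝ) - α + 1) / 2) * Real.Gamma ((α + 1) / 2) /
        Real.pi ^ ((n : ℝ) / 2))) := by
  have hiff := tendsto_boundary_iff_tendsto_ball hn hμ hα hα'
  have hpos : 0 < Real.Gamma (((n : ℝ) - α + 1) / 2) * Real.Gamma ((α + 1) / 2) /
      Real.pi ^ ((n : ℝ) / 2) :=
    div_pos (mul_pos (Real.Gamma_pos_of_pos (by linarith)) (Real.Gamma_pos_of_pos (by linarith)))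
      (by positivity)
  refine ⟨⟨fun ⟨a, ha, h⟩ => ?_, fun ⟨b, hb, h⟩ => ⟨_, mul_nonneg hb hpos.le, (hiff b).2 h⟩⟩,
    fun a b ha hb => tendsto_nhds_unique ha ((hiff b).2 hb)⟩
  refine ⟨_, div_nonneg ha hpos.le, (hiff _).1 ?_⟩
  rwa [div_mul_cancel₀ _ hpos.ne']
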